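/- **Theorem 2.2.** Let $\mathcal Q$ be the infinite square grid in $\mathbb R^2$, with vertex set $\mathbb V_{\mathcal Q}=\mathbb Z^2$ and with edge set $\mathbb E_{\mathcal Q}$ formed by the open unit segments $(i,i+1)\times\{j\}$ and $\{i\}\times(j,j+1)$, $i,j\in\mathbb Z$. Let $|\cdot|$ denote the one-dimensional Hausdorff measure. A *defected grid* is a connected metric graph $\mathcal G=(\mathbb V_{\mathcal G},\mathbb E_{\mathcal G})$ such that (i) $\mathbb V_{\mathcal G}\subset\mathbb V_{\mathcal Q}$ and $\mathbb E_{\mathcal G}\subset\mathbb E_{\mathcal Q}$; (ii) a vertex of $\mathcal Q$ is not in $\mathbb V_{\mathcal G}$ if and only if all the edges of $\mathcal Q$ incident to it are not in $\mathbb E_{\mathcal G}$; (iii) for every $v\in\mathbb V_{\mathcal G}$, $$\liminf_{n\to+\infty}\frac{|B_n(v,\mathcal G)|}{|B_n(v,\mathcal Q)|}>0,$$ where $B_n(v,\mathcal G)$ and $B_n(v,\mathcal Q)$ are the open balls of center $v$ and radius $n$ for the path distances of $\mathcal G$ and $\mathcal Q$ respectively. A *cell* is a cycle of length $4$ in $\mathcal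 Q$. A *defect* of $\mathcal G$ is a non-empty set $\mathcal D\subset\mathbb E_{\mathcal Q}\setminus\mathbb E_{\mathcal G}$ of removed edges such that either (a) $\mathcal D=\{e\}$ and $e$ is the only edge of $\mathbb E_{\mathcal Q}\setminus\mathbb E_{\mathcal G}$ in the two cells that contain $e$; or (b) for any two edges $e,f\in\mathcal D$ there is a finite sequence of cells $S_0,\dots,S_N$ such that $e\in S_0$, $f\in S_N$ and, for every $j=0,\dots,N-1$, the cells $S_j$ and $S_{j+1}$ share exactly one edge and this edge belongs to $\mathcal D$. Suppose that $\mathcal G$ has *uniformly bounded defects*, that is, $$\sup\{|\mathcal D| : \mathcal D\text{ a defect of }\mathcal G\}<+\infty .$$ Then $\mathcal G$ supports the two-dimensional Sobolev inequality: there is a constant $S_{\mathcal G}>0$, depending only on $\mathcal G$, such that $$\|u\|_{L^2(\mathcal G)}\le S_{\mathcal G}\,\|u'\|_{L^1(\mathcal G)}\qquad\text{for every }u\in W^{1,1}(\mathcal G).$$ Here $\|f\|_{L^p(\mathcal G)}^p=\sum_{e\in\mathbb E_{\mathcal G}}\int_0^1|f_e(t)|^p\,dt$, with $f_e$ the restriction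 of $f$ to the edge $e\cong(0,1)$, and $W^{1,1}(\mathcal G)$ is the space of the functions $u:\mathcal G\to\mathbb R$ that are continuous on $\mathcal G$ and weakly differentiable on every edge, with $\|u\|_{L^1(\mathcal G)}+\|u'\|_{L^1(\mathcal G)}<\infty$. -/

import Mathlib

open MeasureTheory Set Filter
open scoped ENNReal ContDiff

noncomputable section

namespace SquareGrid

/-- The Euclidean plane. -/
abbrev Plane : Type := EuclideanSpace ℝ (Fin 2)

/-- The edges of the infinite square grid `Q` with vertex set `ℤ × ℤ`: `hor i j` joins `(i, j)` to
`(i + 1, j)` and `ver i j` joins `(i, j)` to `(i, j + 1)`. -/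
inductive Edge : Type
  | hor (i j : ℤ)
  | ver (i j : ℤ)

namespace Edge

/-- The lower left endpoint of an edge. -/
def src : Edge → ℤ × ℤ
  | hor i j => (i, j)
  | ver i j => (i, j)

/-- The upper right endpoint of an edge. -/
def tgt : Edge → ℤ × ℤ
  | hor i j => (i + 1, j)
  | ver i j => (i, j + 1)

/-- `e.Incident v` means that the vertex `v` is an endpoint of the edge `e`. -/
def Incident (e : Edge) (v : ℤ × ℤ) : Prop := v = e.src ∨ v = e.tgt

/-- The unit speed parametrization of an edge, embedded in the plane; it is used for
`0 ≤ t ≤ 1`. -/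
def point : Edge → ℝ → Plane
  | hor i j, t => !₂[(i : ℝ) + t, (j : ℝ)]
  | ver i j, t => !₂[(i : ℝ), (j : ℝ) + t]

/-- The open unit segment that an edge occupies in the plane. -/
def openSegment (e : Edge) : Set Plane := e.point '' Ioo 0 1

/-- The unit segment of an edge together with its two endpoints. -/
def closedSegment (e : Edge) : Set Plane := e.point '' Icc 0 1

end Edge

/-- A vertex of the grid as a point of the plane. -/
def vertexPoint (v : ℤ × ℤ) : Plane := !₂[(v.1 : ℝ), (v.2 : ℝ)]

/-- The subset of the plane that is occupied by the subgraph of `Q` with edge set `E`. For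
`E = univ` this is the full grid `Q`. -/
def carrier (E : Set Edge) : Set Plane := ⋃ e ∈ E, e.closedSegment

/-- The length (one-dimensional Hausdorff measure) of a subset of the plane. -/
def length (s : Set Plane) : ℝ≥0∞ := Measure.hausdorffMeasure 1 s

/-- `γ` is a path in `Ω` that connects `q` and `r`: the image of a closed interval under a
continuous map that runs from `q` to `r` inside `Ω` and visits every point of `γ` that is neither a
vertex of the grid nor `q` or `r` exactly once. -/
def IsPath (Ω : Set Plane) (q r : Plane) (γ : Set Plane) : Prop :=
  ∃ (a b : ℝ) (f : ℝ → Plane), a ≤ b ∧ ContinuousOn f (Icc a b) ∧ MapsTo f (Icc a b) Ω ∧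
    f a = q ∧ f b = r ∧ γ = f '' Icc a b ∧
    ∀ x ∈ γ \ (range vertexPoint ∪ {q, r}), ∃! t, t ∈ Icc a b ∧ f t = x

/-- The path distance in `Ω` (infinite when no path connects the two points). -/
def pathDist (Ω : Set Plane) (q r : Plane) : ℝ≥0∞ :=
  ⨅ (γ : Set Plane) (_ : IsPath Ω q r γ), length γ

/-- The ball of center `q` and radius `R` in `Ω` for the path distance of `Ω`. -/
def pathBall (Ω : Set Plane) (q : Plane) (R : ℝ≥0∞) : Set Plane :=
  {r | r ∈ Ω ∧ pathDist Ω q r < R}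

/-- The combinatorial graph on the lattice given by a set of edges. -/
def skeleton (E : Set Edge) : SimpleGraph (ℤ × ℤ) :=
  SimpleGraph.fromRel fun v w => ∃ e ∈ E, e.src = v ∧ e.tgt = w

/-- A defected grid: a connected subgraph of `Q` in which a vertex is missing exactly when all the
edges of `Q` incident to it are missing, and whose balls grow in length, up to a factor, like those
of `Q`. -/
structure DefectedGrid where
  /-- the vertices that are present -/
  verts : Set (ℤ × ℤ)
  /-- the edges that are present -/
  edges : Set Edge
  notMem_verts_iff : ∀ v, v ∉ verts ↔ ∀ e : Edge, e.Incident v → e ∉ edges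
  connected : ((skeleton edges).induce verts).Connected
  growth : ∀ v ∈ verts,
    0 < liminf (fun n : ℕ => length (pathBall (carrier edges) (vertexPoint v) n) /
      length (pathBall (carrier univ) (vertexPoint v) n)) atTop

/-- The four edges of the cell (cycle of length four of `Q`) with lower left corner `c`. -/
def cell (c : ℤ × ℤ) : Set Edge :=
  {Edge.hor c.1 c.2, Edge.hor c.1 (c.2 + 1), Edge.ver c.1 c.2, Edge.ver (c.1 + 1) c.2}

namespace DefectedGrid

/-- A defect of `G` is a non-empty set `D` of removed edges such that either `D = {e}` and `e` is
the only removed edge in the (two) cells that contain `e`, or any two edges of `D` are joined by a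
finite chain of cells in which consecutive cells share exactly one edge, and this edge is in `D`. -/
def IsDefect (G : DefectedGrid) (D : Set Edge) : Prop :=
  D.Nonempty ∧ D ⊆ G.edgesᶜ ∧
    ((∃ e, D = {e} ∧ (⋃ c ∈ {c | e ∈ cell c}, cell c) ∩ G.edgesᶜ = {e}) ∨
      ∀ e ∈ D, ∀ f ∈ D, ∃ (N : ℕ) (S : ℕ → ℤ × ℤ), e ∈ cell (S 0) ∧ f ∈ cell (S N) ∧
        ∀ j < N, ∃ d ∈ D, cell (S j) ∩ cell (S (j + 1)) = {d})

/-- The lengths of the defects of `G` are bounded by a common finite constant. -/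
def HasUniformlyBoundedDefects (G : DefectedGrid) : Prop :=
  ⨆ (D : Set Edge) (_ : G.IsDefect D), length (⋃ e ∈ D, e.openSegment) < ⊤

/-- The `L^p` norm (`1 ≤ p < ∞`) on `G` of a family of functions on the edges, each edge being
identified with `(0, 1)`. -/
def lpNorm (G : DefectedGrid) (p : ℝ) (f : Edge → ℝ → ℝ) : ℝ≥0∞ :=
  (∑' e : G.edges, ∫⁻ t in Ioo (0 : ℝ) 1, ‖f e t‖ₑ ^ p) ^ (1 / p)

end DefectedGrid

/-- The family of the restrictions of a function to the edges. -/
def onEdges (u : Plane → ℝ) : Edge → ℝ → ℝ := fun e t => u (e.point t)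

/-- `g` is the weak derivative of `f` on the interval `(0, 1)`. -/
def IsWeakDeriv (f g : ℝ → ℝ) : Prop :=
  LocallyIntegrableOn f (Ioo 0 1) ∧ LocallyIntegrableOn g (Ioo 0 1) ∧
    ∀ φ : ℝ → ℝ, ContDiff ℝ ∞ φ → HasCompactSupport φ → tsupport φ ⊆ Ioo 0 1 →
      ∫ t in Ioo (0 : ℝ) 1, f t * deriv φ t = -∫ t in Ioo (0 : ℝ) 1, g t * φ t

namespace DefectedGrid

/-- `u` is in `W^{1,1}(G)` with (edgewise weak) derivative `u'`: `u` is continuous on `G`, and `u`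
and `u'` have finite `L^1` norm on `G`. Only the values of `u` on `G` are constrained. -/
structure IsW11 (G : DefectedGrid) (u : Plane → ℝ) (u' : Edge → ℝ → ℝ) : Prop where
  continuousOn : ContinuousOn u (carrier G.edges)
  weakDeriv : ∀ e ∈ G.edges, IsWeakDeriv (onEdges u e) (u' e)
  norm_lt_top : G.lpNorm 1 (onEdges u) < ⊤
  norm_deriv_lt_top : G.lpNorm 1 u' < ⊤

/-- `G` supports the two-dimensional Sobolev inequality `‖u‖_{L^2(G)} ≤ S ‖u'‖_{L^1(G)}` on
`W^{1,1}(G)`, with a positive constant `S` that depends only on `G`. -/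
def SupportsSobolev2D (G : DefectedGrid) : Prop :=
  ∃ S : ℝ, 0 < S ∧ ∀ (u : Plane → ℝ) (u' : Edge → ℝ → ℝ), G.IsW11 u u' →
    G.lpNorm 2 (onEdges u) ≤ ENNReal.ofReal S * G.lpNorm 1 u'

end DefectedGrid

end SquareGrid

end

/-! On the full grid this is the Gagliardo–Nirenberg argument. A function that becomes small along
every ray is bounded at `(i, j)` both by its variation along the row and by its variation along the
column; the product of the two bounds sums to at most the square of the total variation
(`tsum_enorm_sq_le`). It therefore suffices to extend the vertex values of `u` from `G` to `ℤ × ℤ`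
with control of the total variation.

Join two cells when they share a removed edge. The removed edges of a class of joined cells form a
defect, so there are at most `maxDefect` of them. The heart of the proof is that values at vertices
of `G` around a class differ by at most the variation along its rim, the present edges of its cells
(`enorm_sub_le_tsum_rim`). By a coarea argument this reduces to functions constant along the rim
(`eq_of_forall_rim`). That case replaces planar topology by cohomology: the differential of such a
function, cut off outside the class, is still closed, hence exact, and its potential is constant on
the connected graph `G`.

A missing vertex receives the value at a vertex of `G` on its class. Each removed edge then costs at
most one rim, and each present edge lies in the rims of at most two classes, so the variation grows
at most by the factor `1 + 2 * maxDefect` (`exists_extension`). Inside an edge, `u` oscillates by at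
most the integral of `|u'|`, so vertex values suffice. -/

noncomputable section

namespace SquareGrid

open scoped Topology

/-! ### Exactness of closed integer forms on the grid -/

/-- Every integer sequence indexed by `ℤ` has an antidifference vanishing at `0`. -/
theorem exists_int_antidifference (s : ℤ → ℤ) :
    ∃ S : ℤ → ℤ, S 0 = 0 ∧ ∀ n, S (n + 1) - S n = s n := by
  refine ⟨fun n => ∑ k ∈ Finset.Ico 0 n, s k - ∑ k ∈ Finset.Ico n 0, s k, by simp, fun n => ?_⟩
  rcases le_or_gt 0 n with h | h
  · have h1 : Finset.Ico n 0 = ∅ := by simpa using h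
    have h2 : Finset.Ico (n + 1) 0 = ∅ := by simp; omega
    have h3 : Finset.Ico 0 (n + 1) = insert n (Finset.Ico 0 n) := by ext; simp; omega
    simp [h1, h2, h3]
  · have h1 : Finset.Ico 0 n = ∅ := by simp; omega
    have h2 : Finset.Ico 0 (n + 1) = ∅ := by simp; omega
    have h3 : Finset.Ico n 0 = insert n (Finset.Ico (n + 1) 0) := by ext; simp; omega
    simp [h1, h2, h3]

/-- Discrete Poincaré lemma: a closed integer `1`-form on the square grid is exact. -/
theorem exists_potential (η : Edge → ℤ)
    (hη : ∀ i j, η (.hor i j) + η (.ver (i + 1) j) = η (.ver i j) + η (.hor i (j + 1))) :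
    ∃ h : ℤ × ℤ → ℤ, ∀ e : Edge, h e.tgt - h e.src = η e := by
  obtain ⟨P, -, hP⟩ := exists_int_antidifference fun i => η (.hor i 0)
  choose Q hQ0 hQ using fun i => exists_int_antidifference fun j => η (.ver i j)
  have key : ∀ i j, Q (i + 1) j - Q i j = η (.hor i j) - η (.hor i 0) := by
    intro i j
    induction j using Int.induction_on with
    | zero => simp [hQ0]
    | succ k ih =>
      have := hQ i k; have := hQ (i + 1) k; have := hη i k
      omega
    | pred k ih =>
      have h1 := hQ i (-k - 1)
      have h2 := hQ (i + 1) (-k - 1)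
      have h3 := hη i (-k - 1)
      simp only [sub_add_cancel] at h1 h2 h3
      omega
  -- Up to a constant, the integral of `η` from the origin along the horizontal axis and then along
  -- the column; `key` is path independence.
  refine ⟨fun v => P v.1 + Q v.1 v.2, ?_⟩
  rintro (⟨i, j⟩ | ⟨i, j⟩)
  · have := key i j; have := hP i
    simp only [Edge.tgt, Edge.src]
    omega
  · have := hQ i j
    simp only [Edge.tgt, Edge.src]
    omega

/-! ### Cells, their corners and their common edges -/

/-- The four vertices of the cell with lower left corner `c`. -/
def corners (c : ℤ × ℤ) : Set (ℤ × ℤ) :=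
  {c, (c.1 + 1, c.2), (c.1, c.2 + 1), (c.1 + 1, c.2 + 1)}

theorem mem_corners_of_incident {c v : ℤ × ℤ} {e : Edge} (he : e ∈ cell c) (hv : e.Incident v) :
    v ∈ corners c := by
  rcases e with ⟨i, j⟩ | ⟨i, j⟩ <;> rcases v with ⟨x, y⟩ <;> rcases c with ⟨p, q⟩ <;>
    simp only [cell, corners, Edge.Incident, Edge.src, Edge.tgt, mem_insert_iff,
      mem_singleton_iff, Edge.hor.injEq, Edge.ver.injEq, reduceCtorEq, Prod.mk.injEq,
      false_or, or_false] at * <;> omega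

theorem cell_inter_right (i j : ℤ) : cell (i, j) ∩ cell (i + 1, j) = {Edge.ver (i + 1) j} := by
  ext e
  rcases e with ⟨x, y⟩ | ⟨x, y⟩ <;>
    simp only [cell, mem_inter_iff, mem_insert_iff, mem_singleton_iff, Edge.hor.injEq,
      Edge.ver.injEq, reduceCtorEq, false_or, or_false, iff_false] <;> omega

theorem cell_inter_up (i j : ℤ) : cell (i, j) ∩ cell (i, j + 1) = {Edge.hor i (j + 1)} := by
  ext e
  rcases e with ⟨x, y⟩ | ⟨x, y⟩ <;>
    simp only [cell, mem_inter_iff, mem_insert_iff, mem_singleton_iff, Edge.hor.injEq,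
      Edge.ver.injEq, reduceCtorEq, false_or, or_false, iff_false] <;> omega

/-- The cell on the lower left side of an edge; the other cell that contains the edge has the
lower left corner `e.src`. -/
def Edge.cellOpp : Edge → ℤ × ℤ
  | .hor i j => (i, j - 1)
  | .ver i j => (i - 1, j)

theorem mem_cell_iff {e : Edge} {c : ℤ × ℤ} : e ∈ cell c ↔ c = e.src ∨ c = e.cellOpp := by
  rcases e with ⟨i, j⟩ | ⟨i, j⟩ <;> rcases c with ⟨p, q⟩ <;>
    simp only [cell, Edge.src, Edge.cellOpp, mem_insert_iff, mem_singleton_iff, Edge.hor.injEq,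
      Edge.ver.injEq, reduceCtorEq, Prod.mk.injEq, false_or, or_false] <;> omega

theorem cellOpp_inter_src (e : Edge) : cell e.cellOpp ∩ cell e.src = {e} := by
  rcases e with ⟨i, j⟩ | ⟨i, j⟩
  · simpa [Edge.src, Edge.cellOpp] using cell_inter_up i (j - 1)
  · simpa [Edge.src, Edge.cellOpp] using cell_inter_right (i - 1) j

/-- A function that is constant on the edges of a cell is constant on its corners. -/
theorem eq_of_mem_corners {α : Type*} {g : ℤ × ℤ → α} {c : ℤ × ℤ}
    (hg : ∀ e ∈ cell c, g e.src = g e.tgt) {a : ℤ × ℤ} (ha : a ∈ corners c) : g a = g c := by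
  have h1 := hg (.hor c.1 c.2) (by simp [cell])
  have h2 := hg (.hor c.1 (c.2 + 1)) (by simp [cell])
  have h3 := hg (.ver c.1 c.2) (by simp [cell])
  simp only [Edge.src, Edge.tgt] at h1 h2 h3
  rcases ha with rfl | rfl | rfl | rfl
  · rfl
  · exact h1.symm
  · exact h3.symm
  · exact h2.symm.trans h3.symm

/-! ### Classes of cells joined across removed edges -/

namespace DefectedGrid

variable (G : DefectedGrid)

/-- Two cells are adjacent across a removed edge. -/
def CellAdj (c c' : ℤ × ℤ) : Prop := ∃ d ∉ G.edges, cell c ∩ cell c' = {d}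

/-- Two cells are joined by a chain of cells adjacent across removed edges. -/
def CellRel : ℤ × ℤ → ℤ × ℤ → Prop := Relation.ReflTransGen G.CellAdj

/-- The removed edges of the cells joined to `c`. -/
def cluster (c : ℤ × ℤ) : Set Edge := {e | e ∉ G.edges ∧ ∃ c', G.CellRel c c' ∧ e ∈ cell c'}

/-- The edges present in the cells joined to `c`. -/
def rim (c : ℤ × ℤ) : Set Edge := {e | e ∈ G.edges ∧ ∃ c', G.CellRel c c' ∧ e ∈ cell c'}

variable {G}

theorem CellAdj.symm {c c' : ℤ × ℤ} (h : G.CellAdj c c') : G.CellAdj c' c := by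
  obtain ⟨d, hd, h⟩ := h
  exact ⟨d, hd, by rw [inter_comm, h]⟩

theorem CellRel.symm {c c' : ℤ × ℤ} (h : G.CellRel c c') : G.CellRel c' c :=
  (@Relation.ReflTransGen.stdSymm _ _ ⟨fun _ _ => CellAdj.symm⟩).symm _ _ h

theorem CellRel.trans {a b c : ℤ × ℤ} (h : G.CellRel a b) (h' : G.CellRel b c) : G.CellRel a c :=
  Relation.ReflTransGen.trans h h'

theorem CellRel.refl (c : ℤ × ℤ) : G.CellRel c c := Relation.ReflTransGen.refl

theorem cellRel_of_mem_cell {e : Edge} (he : e ∉ G.edges) {c c' : ℤ × ℤ} (h : e ∈ cell c)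
    (h' : e ∈ cell c') : G.CellRel c c' := by
  have key : G.CellRel e.cellOpp e.src := .single ⟨e, he, cellOpp_inter_src e⟩
  rcases mem_cell_iff.1 h with rfl | rfl <;> rcases mem_cell_iff.1 h' with rfl | rfl
  exacts [.refl _, key.symm, key, .refl _]

/-- Chains in the indexed form that defects require; keeping every `S j` joined to `c` ensures that
the crossed edges belong to the cluster. -/
theorem CellRel.exists_chain {c c' : ℤ × ℤ} (h : G.CellRel c c') :
    ∃ (N : ℕ) (S : ℕ → ℤ × ℤ), S 0 = c ∧ S N = c' ∧
      ∀ j < N, G.CellRel c (S j) ∧ G.CellAdj (S j) (S (j + 1)) := by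
  induction h with
  | refl => exact ⟨0, fun _ => c, rfl, rfl, by simp⟩
  | @tail b d hb hbd ih =>
    obtain ⟨N, S, h0, hN, h⟩ := ih
    refine ⟨N + 1, fun n => if n ≤ N then S n else d, by simpa using h0, by simp, fun j hj => ?_⟩
    rcases Nat.lt_succ_iff_lt_or_eq.1 hj with hj | rfl
    · simpa [hj.le, Nat.succ_le_of_lt hj] using h j hj
    · simpa [hN] using ⟨hb, hbd⟩

theorem isDefect_cluster {c : ℤ × ℤ} (h : (G.cluster c).Nonempty) : G.IsDefect (G.cluster c) := by
  refine ⟨h, fun e he => he.1, Or.inr ?_⟩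
  rintro e ⟨-, a, ha, hea⟩ f ⟨-, b, hb, hfb⟩
  obtain ⟨N, S, h0, hN, hS⟩ := (ha.symm.trans hb).exists_chain
  refine ⟨N, S, h0 ▸ hea, hN ▸ hfb, fun j hj => ?_⟩
  obtain ⟨h1, d, hd, h2⟩ := hS j hj
  refine ⟨d, ⟨hd, S j, ha.trans h1, ?_⟩, h2⟩
  exact (h2 ▸ mem_singleton d : d ∈ cell (S j) ∩ cell (S (j + 1))).1

theorem mem_verts_of_incident {e : Edge} (he : e ∈ G.edges) {v : ℤ × ℤ} (hv : e.Incident v) :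
    v ∈ G.verts := by
  by_contra h
  exact (G.notMem_verts_iff v).1 h e hv he

theorem exists_incident {v : ℤ × ℤ} (hv : v ∈ G.verts) : ∃ e ∈ G.edges, e.Incident v := by
  by_contra! h
  exact (G.notMem_verts_iff v).2 (fun e he h' => h e h' he) hv

/-- A function that is constant along the edges of `G` is constant on the vertices of `G`. -/
theorem eq_of_forall_edges {α : Type*} (h : ℤ × ℤ → α) (hh : ∀ e ∈ G.edges, h e.src = h e.tgt)
    {a b : ℤ × ℤ} (ha : a ∈ G.verts) (hb : b ∈ G.verts) : h a = h b := by
  obtain ⟨w⟩ := G.connected.preconnected ⟨a, ha⟩ ⟨b, hb⟩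
  have key : ∀ x y : G.verts, ((skeleton G.edges).induce G.verts).Walk x y → h x = h y := by
    intro x y w
    induction w with
    | nil => rfl
    | cons hadj _ ih =>
      rw [← ih]
      obtain ⟨-, ⟨e, he, h1, h2⟩ | ⟨e, he, h1, h2⟩⟩ := hadj
      · have := hh e he
        rw [h1, h2] at this
        exact this
      · have := hh e he
        rw [h1, h2] at this
        exact this.symm
  exact key _ _ w

/-- A function that is constant along the edges of `G` in the cells joined to `c` takes a single
value at the vertices of `G` among the corners of these cells. -/
theorem eq_of_forall_rim (χ : ℤ × ℤ → ℤ) (c : ℤ × ℤ)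
    (hχ : ∀ e ∈ G.rim c, χ e.src = χ e.tgt) {a b p q : ℤ × ℤ} (ha : a ∈ G.verts)
    (hb : b ∈ G.verts) (hp : G.CellRel c p) (hq : G.CellRel c q) (hap : a ∈ corners p)
    (hbq : b ∈ corners q) : χ a = χ b := by
  classical
  -- The differential of `χ`, cut off outside the class. It agrees with the full differential on
  -- cells of the class, because `χ` does not vary along the rim, and vanishes on all other cells;
  -- so it is closed.
  set η : Edge → ℤ := fun e => if e ∈ G.cluster c then χ e.tgt - χ e.src else 0 with hη
  have hin : ∀ d, G.CellRel c d → ∀ e ∈ cell d, η e = χ e.tgt - χ e.src := by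
    intro d hd e he
    by_cases h : e ∈ G.cluster c
    · simp [hη, h]
    · have : e ∈ G.edges := by
        by_contra h'
        exact h ⟨h', d, hd, he⟩
      simp [hη, h, hχ e ⟨this, d, hd, he⟩]
  have hout : ∀ d, ¬ G.CellRel c d → ∀ e ∈ cell d, η e = 0 := by
    intro d hd e he
    refine if_neg ?_
    rintro ⟨h1, d', h2, h3⟩
    exact hd (h2.trans (cellRel_of_mem_cell h1 h3 he))
  obtain ⟨h, hh⟩ := exists_potential η (by
    intro i j
    have m1 : Edge.hor i j ∈ cell (i, j) := by simp [cell]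
    have m2 : Edge.ver (i + 1) j ∈ cell (i, j) := by simp [cell]
    have m3 : Edge.ver i j ∈ cell (i, j) := by simp [cell]
    have m4 : Edge.hor i (j + 1) ∈ cell (i, j) := by simp [cell]
    by_cases hd : G.CellRel c (i, j)
    · rw [hin _ hd _ m1, hin _ hd _ m2, hin _ hd _ m3, hin _ hd _ m4]
      simp only [Edge.src, Edge.tgt]
      ring
    · rw [hout _ hd _ m1, hout _ hd _ m2, hout _ hd _ m3, hout _ hd _ m4])
  -- Here the connectedness of `G` enters: `η` vanishes on all edges of `G`.
  have hconst : h a = h b := by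
    refine eq_of_forall_edges h (fun e he => ?_) ha hb
    have : η e = 0 := if_neg fun h' => h'.1 he
    have := hh e
    omega
  have hcell : ∀ d, G.CellRel c d → ∀ e ∈ cell d,
      h e.src - χ e.src = h e.tgt - χ e.tgt := by
    intro d hd e he
    have := hh e
    have := hin d hd e he
    omega
  -- `h - χ` is constant on the corners of each cell of the class, and adjacent cells share corners.
  have hrel : ∀ d, G.CellRel c d → h d - χ d = h c - χ c := by
    intro d hd
    induction hd with
    | refl => rfl
    | @tail d d' hd hdd ih =>
      rw [← ih]
      obtain ⟨e, -, he⟩ := id hdd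
      have he : e ∈ cell d ∩ cell d' := he ▸ mem_singleton e
      have h1 := eq_of_mem_corners (g := fun v => h v - χ v) (hcell d hd)
        (mem_corners_of_incident he.1 (Or.inl rfl))
      have h2 := eq_of_mem_corners (g := fun v => h v - χ v) (hcell d' (hd.tail hdd))
        (mem_corners_of_incident he.2 (Or.inl rfl))
      exact h2.symm.trans h1
  have h1 := eq_of_mem_corners (g := fun v => h v - χ v) (hcell p hp) hap
  have h2 := eq_of_mem_corners (g := fun v => h v - χ v) (hcell q hq) hbq
  have h3 := hrel p hp
  have h4 := hrel q hq
  omega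

end DefectedGrid

/-! ### Sums over edges and oscillation around a class -/

/-- The edges of the grid as pairs of lattice points. -/
def edgeEquiv : (ℤ × ℤ) ⊕ (ℤ × ℤ) ≃ Edge where
  toFun := Sum.elim (fun v => .hor v.1 v.2) (fun v => .ver v.1 v.2)
  invFun
    | .hor i j => .inl (i, j)
    | .ver i j => .inr (i, j)
  left_inv := by rintro (v | v) <;> rfl
  right_inv := by rintro (_ | _) <;> rfl

instance : Countable Edge := edgeEquiv.symm.injective.countable

theorem tsum_edge (F : Edge → ℝ≥0∞) :
    ∑' e, F e = ∑' v : ℤ × ℤ, F (.hor v.1 v.2) + ∑' v : ℤ × ℤ, F (.ver v.1 v.2) := by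
  rw [← edgeEquiv.tsum_eq F]
  exact Summable.tsum_sum ENNReal.summable ENNReal.summable

namespace DefectedGrid

variable {G : DefectedGrid}

/-- Coarea argument: each level between the two values must be crossed by some rim edge, so the
intervals spanned by the rim edges cover the interval between them. -/
theorem enorm_sub_le_tsum_rim (f : ℤ × ℤ → ℝ) (c : ℤ × ℤ) {a b p q : ℤ × ℤ} (ha : a ∈ G.verts)
    (hb : b ∈ G.verts) (hp : G.CellRel c p) (hq : G.CellRel c q) (hap : a ∈ corners p)
    (hbq : b ∈ corners q) : ‖f a - f b‖ₑ ≤ ∑' e : G.rim c, ‖f e.1.tgt - f e.1.src‖ₑ := by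
  classical
  wlog hab : f a ≤ f b generalizing a b p q
  · rw [← enorm_neg, neg_sub]
    exact this hb ha hq hp hbq hap (le_of_not_ge hab)
  have hsub : Ico (f a) (f b) ⊆ ⋃ e : G.rim c, uIcc (f e.1.src) (f e.1.tgt) := by
    intro t ht
    by_contra hcon
    -- If no rim edge crosses the level `t`, the indicator of `f > t` is constant along the rim, yet
    -- it separates `a` from `b`.
    have key := eq_of_forall_rim (G := G) (fun v => if f v ≤ t then 0 else 1) c (fun e he => by
      have h : t ∉ uIcc (f e.src) (f e.tgt) := fun h => hcon (mem_iUnion.2 ⟨⟨e, he⟩, h⟩)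
      rw [mem_uIcc] at h
      push Not at h
      by_cases h1 : f e.src ≤ t
      · have h2 : f e.tgt ≤ t := (h.1 h1).le
        simp [h1, h2]
      · have h2 : ¬ f e.tgt ≤ t := fun h2 => h1 (h.2 h2).le
        simp [h1, h2]) ha hb hp hq hap hbq
    simp [ht.1, not_le.2 ht.2] at key
  calc ‖f a - f b‖ₑ = volume (Ico (f a) (f b)) := by
        rw [Real.volume_Ico, ← enorm_neg, neg_sub, Real.enorm_of_nonneg (by linarith)]
    _ ≤ _ := measure_mono hsub
    _ ≤ _ := measure_iUnion_le _
    _ = _ := by simp [Real.volume_interval, Real.enorm_eq_ofReal_abs]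

theorem cellRel_right {i j : ℤ} (h : (i + 1, j) ∉ G.verts) : G.CellRel (i, j) (i + 1, j) :=
  .single ⟨_, (G.notMem_verts_iff _).1 h (.ver (i + 1) j) (Or.inl rfl), cell_inter_right i j⟩

theorem cellRel_up {i j : ℤ} (h : (i, j + 1) ∉ G.verts) : G.CellRel (i, j) (i, j + 1) :=
  .single ⟨_, (G.notMem_verts_iff _).1 h (.hor i (j + 1)) (Or.inl rfl), cell_inter_up i j⟩

/-- The cells around a missing vertex are joined to each other. -/
theorem cellRel_of_notMem_verts {v c : ℤ × ℤ} (hv : v ∉ G.verts) (hc : v ∈ corners c) :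
    G.CellRel c v := by
  rcases c with ⟨i, j⟩
  rcases hc with rfl | rfl | rfl | rfl
  · exact .refl _
  · exact cellRel_right hv
  · exact cellRel_up hv
  · refine CellRel.trans (b := (i, j + 1)) (.single ⟨.hor i (j + 1), ?_, cell_inter_up i j⟩)
      (cellRel_right hv)
    exact (G.notMem_verts_iff _).1 hv _ (Or.inr rfl)

end DefectedGrid

/-! ### Oscillation controlled by the weak derivative -/

theorem abs_setIntegral_mul_normed_sub_le {f : ℝ → ℝ} (hf : ContinuousOn f (Icc 0 1)) {s δ : ℝ}
    (ρ : ContDiffBump s) (hρ : Metric.ball s ρ.rOut ⊆ Ioo 0 1)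
    (hδ : ∀ x ∈ Metric.ball s ρ.rOut, |f x - f s| ≤ δ) :
    IntegrableOn (fun x => f x * ρ.normed volume x) (Ioo 0 1) ∧
      |(∫ x in Ioo (0 : ℝ) 1, f x * ρ.normed volume x) - f s| ≤ δ := by
  have hsupp : ∀ x, x ∉ Metric.ball s ρ.rOut → ρ.normed volume x = 0 := fun x hx => by
    rw [← Function.notMem_support, ρ.support_normed_eq]
    exact hx
  have hone : ∫ x in Ioo (0 : ℝ) 1, ρ.normed volume x = 1 := by
    rw [setIntegral_eq_integral_of_forall_compl_eq_zero fun x hx => hsupp x fun h => hx (hρ h),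
      ρ.integral_normed]
  have hint : IntegrableOn (fun x => f x * ρ.normed volume x) (Ioo 0 1) :=
    ((hf.mul ρ.continuous_normed.continuousOn).integrableOn_Icc).mono_set Ioo_subset_Icc_self
  have hn : IntegrableOn (ρ.normed volume) (Ioo 0 1) := ρ.integrable_normed.integrableOn
  refine ⟨hint, ?_⟩
  have h1 : (∫ x in Ioo (0 : ℝ) 1, f x * ρ.normed volume x) - f s =
      ∫ x in Ioo (0 : ℝ) 1, (f x - f s) * ρ.normed volume x := by
    simp_rw [sub_mul]
    rw [integral_sub hint (hn.const_mul _), integral_const_mul, hone, mul_one]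
  rw [h1]
  have h2 : ∫ x in Ioo (0 : ℝ) 1, δ * ρ.normed volume x = δ := by
    rw [integral_const_mul, hone, mul_one]
  have h3 : ∀ x, ‖(f x - f s) * ρ.normed volume x‖ ≤ δ * ρ.normed volume x := fun x => by
    rw [norm_mul, Real.norm_of_nonneg (ρ.nonneg_normed x)]
    by_cases hx : x ∈ Metric.ball s ρ.rOut
    · exact mul_le_mul_of_nonneg_right (hδ x hx) (ρ.nonneg_normed x)
    · simp [hsupp x hx]
  have h4 := norm_integral_le_of_norm_le (hn.const_mul δ) (ae_of_all _ h3)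
  rwa [h2] at h4

theorem normed_primitive_bounds {s : ℝ} (ρ : ContDiffBump s) {x : ℝ} (hx : 0 ≤ x) :
    0 ≤ ∫ y in (0 : ℝ)..x, ρ.normed volume y ∧ ∫ y in (0 : ℝ)..x, ρ.normed volume y ≤ 1 := by
  refine ⟨intervalIntegral.integral_nonneg hx fun y _ => ρ.nonneg_normed y, ?_⟩
  rw [intervalIntegral.integral_of_le hx, ← ρ.integral_normed (μ := volume)]
  exact setIntegral_le_integral ρ.integrable_normed (ae_of_all _ ρ.nonneg_normed)

theorem normed_primitive_eq_zero {s : ℝ} (ρ : ContDiffBump s) (h0 : 0 ≤ s - ρ.rOut) {x : ℝ}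
    (hx : x ≤ s - ρ.rOut) : ∫ y in (0 : ℝ)..x, ρ.normed volume y = 0 := by
  refine intervalIntegral.integral_zero_ae (ae_of_all _ fun y hy => ?_)
  rw [← Function.notMem_support, ρ.support_normed_eq, Real.ball_eq_Ioo]
  rintro ⟨h1, -⟩
  have := hy.2.trans (max_le h0 hx)
  linarith

theorem normed_primitive_eq_one {s : ℝ} (ρ : ContDiffBump s) (h0 : 0 ≤ s - ρ.rOut) {x : ℝ}
    (hx : s + ρ.rOut ≤ x) : ∫ y in (0 : ℝ)..x, ρ.normed volume y = 1 := by
  rw [intervalIntegral.integral_eq_integral_of_support_subset, ρ.integral_normed]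
  rw [ρ.support_normed_eq, Real.ball_eq_Ioo]
  exact fun y hy => ⟨h0.trans_lt hy.1, hy.2.le.trans hx⟩

/-- The test function has derivative `ρ - τ`, for bumps of mass one at `s` and `t`. Its absolute
value is at most one, and pairing `f` with its derivative gives `f s - f t` up to `δ`. -/
theorem IsWeakDeriv.enorm_sub_le_of_lt {f g : ℝ → ℝ} (h : IsWeakDeriv f g)
    (hf : ContinuousOn f (Icc 0 1)) {s t : ℝ} (hs : 0 < s) (hst : s < t) (ht : t < 1) :
    ‖f s - f t‖ₑ ≤ ∫⁻ x in Ioo (0 : ℝ) 1, ‖g x‖ₑ := by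
  refine ENNReal.le_of_forall_pos_le_add fun δ hδ _ => ?_
  have hδ' : (0 : ℝ) < δ / 2 := by positivity
  have hloc : ∀ x ∈ Ioo (0 : ℝ) 1, ∃ r > 0, ∀ y ∈ Metric.ball x r, |f y - f x| ≤ δ / 2 := by
    intro x hx
    have hc := hf.continuousAt (Icc_mem_nhds hx.1 hx.2)
    obtain ⟨r, hr, hr'⟩ := Metric.continuousAt_iff.1 hc _ hδ'
    exact ⟨r, hr, fun y hy => (hr' hy).le⟩
  obtain ⟨r₁, hr₁, hs'⟩ := hloc s ⟨hs, hst.trans ht⟩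
  obtain ⟨r₂, hr₂, ht'⟩ := hloc t ⟨hs.trans hst, ht⟩
  -- The radius keeps both bumps inside `(0, 1)` and the error of each average at most `δ / 2`.
  obtain ⟨r, hr, hr1, hr2, hr3, hr4⟩ : ∃ r > 0, r < r₁ ∧ r < r₂ ∧ r < s ∧ r < 1 - t := by
    obtain ⟨r, h0, h1⟩ := exists_between
      (show 0 < min (min r₁ r₂) (min s (1 - t)) by simp [hr₁, hr₂, hs, ht])
    simp only [lt_min_iff] at h1
    exact ⟨r, h0, h1.1.1, h1.1.2, h1.2.1, h1.2.2⟩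
  let ρ : ContDiffBump s := ⟨r / 2, r, by positivity, by linarith⟩
  let τ : ContDiffBump t := ⟨r / 2, r, by positivity, by linarith⟩
  have hρr : ρ.rOut = r := rfl
  have hτr : τ.rOut = r := rfl
  let φ : ℝ → ℝ := fun x =>
    (∫ y in (0 : ℝ)..x, ρ.normed volume y) - ∫ y in (0 : ℝ)..x, τ.normed volume y
  have hder : ∀ x, HasDerivAt φ (ρ.normed volume x - τ.normed volume x) x := fun x =>
    (ρ.continuous_normed.integral_hasStrictDerivAt 0 x).hasDerivAt.sub
      (τ.continuous_normed.integral_hasStrictDerivAt 0 x).hasDerivAt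
  have hderiv : deriv φ = fun x => ρ.normed volume x - τ.normed volume x :=
    funext fun x => (hder x).deriv
  have hsmooth : ContDiff ℝ ∞ φ := by
    refine contDiff_infty_iff_deriv.2 ⟨fun x => (hder x).differentiableAt, ?_⟩
    rw [hderiv]
    exact ρ.contDiff_normed.sub τ.contDiff_normed
  have hzero : ∀ x ∉ Icc (s - r) (t + r), φ x = 0 := by
    intro x hx
    rcases lt_or_ge x (s - r) with h1 | h1
    · have e1 := normed_primitive_eq_zero ρ (by linarith) (x := x) (by linarith)
      have e2 := normed_primitive_eq_zero τ (by linarith) (x := x) (by linarith)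
      simp [φ, e1, e2]
    · have h2 : t + r < x := not_le.1 fun h2 => hx ⟨h1, h2⟩
      have e1 := normed_primitive_eq_one ρ (by linarith) (x := x) (by linarith)
      have e2 := normed_primitive_eq_one τ (by linarith) (x := x) (by linarith)
      simp [φ, e1, e2]
  have hts : tsupport φ ⊆ Icc (s - r) (t + r) :=
    closure_minimal (fun x hx => not_imp_comm.1 (hzero x) hx) isClosed_Icc
  have hweak := h.2.2 φ hsmooth (HasCompactSupport.intro isCompact_Icc hzero)
    (hts.trans fun x hx => ⟨by linarith [hx.1], by linarith [hx.2]⟩)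
  obtain ⟨i1, b1⟩ := abs_setIntegral_mul_normed_sub_le hf (δ := δ / 2) ρ
    (by rw [Real.ball_eq_Ioo]; exact fun x hx => ⟨by linarith [hx.1], by linarith [hx.2]⟩)
    (fun x hx => hs' x (Metric.ball_subset_ball hr1.le hx))
  obtain ⟨i2, b2⟩ := abs_setIntegral_mul_normed_sub_le hf (δ := δ / 2) τ
    (by rw [Real.ball_eq_Ioo]; exact fun x hx => ⟨by linarith [hx.1], by linarith [hx.2]⟩)
    (fun x hx => ht' x (Metric.ball_subset_ball hr2.le hx))
  simp_rw [hderiv, mul_sub] at hweak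
  rw [integral_sub i1 i2] at hweak
  have hφ : ‖∫ x in Ioo (0 : ℝ) 1, g x * φ x‖ₑ ≤ ∫⁻ x in Ioo (0 : ℝ) 1, ‖g x‖ₑ := by
    refine (enorm_integral_le_lintegral_enorm _).trans
      (setLIntegral_mono' measurableSet_Ioo fun x hx => ?_)
    rw [enorm_mul]
    refine mul_le_of_le_one_right' ?_
    rw [Real.enorm_eq_ofReal_abs, ENNReal.ofReal_le_one, abs_le]
    have e1 := normed_primitive_bounds ρ hx.1.le
    have e2 := normed_primitive_bounds τ hx.1.le
    constructor <;> simp only [φ] <;> linarith [e1.1, e1.2, e2.1, e2.2]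
  set A := ∫ x in Ioo (0 : ℝ) 1, f x * ρ.normed volume x
  set B := ∫ x in Ioo (0 : ℝ) 1, f x * τ.normed volume x
  have hd : ‖(B - f t) - (A - f s)‖ₑ ≤ δ := by
    rw [Real.enorm_eq_ofReal_abs]
    refine (ENNReal.ofReal_le_ofReal ((abs_sub _ _).trans (add_le_add b2 b1))).trans ?_
    simp
  calc ‖f s - f t‖ₑ = ‖(A - B) + ((B - f t) - (A - f s))‖ₑ := by congr 1; ring
    _ ≤ ‖A - B‖ₑ + ‖(B - f t) - (A - f s)‖ₑ := enorm_add_le _ _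
    _ ≤ _ := add_le_add (by rw [hweak, enorm_neg]; exact hφ) hd

/-- The oscillation of a continuous function on the unit interval is at most the total mass of its
weak derivative. -/
theorem IsWeakDeriv.enorm_sub_le {f g : ℝ → ℝ} (h : IsWeakDeriv f g)
    (hf : ContinuousOn f (Icc 0 1)) {s t : ℝ} (hs : s ∈ Icc (0 : ℝ) 1) (ht : t ∈ Icc (0 : ℝ) 1) :
    ‖f s - f t‖ₑ ≤ ∫⁻ x in Ioo (0 : ℝ) 1, ‖g x‖ₑ := by
  have hlim : ∀ x ∈ Icc (0 : ℝ) 1, Tendsto f (𝓝[Ioo 0 1] x) (𝓝 (f x)) ∧ (𝓝[Ioo (0 : ℝ) 1] x).NeBot :=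
    fun x hx => ⟨(hf x hx).mono Ioo_subset_Icc_self,
      mem_closure_iff_nhdsWithin_neBot.1 (by rwa [closure_Ioo zero_ne_one])⟩
  have hopen : ∀ x ∈ Ioo (0 : ℝ) 1, ∀ y ∈ Ioo (0 : ℝ) 1,
      ‖f x - f y‖ₑ ≤ ∫⁻ x in Ioo (0 : ℝ) 1, ‖g x‖ₑ := by
    intro x hx y hy
    rcases lt_trichotomy x y with hxy | rfl | hxy
    · exact h.enorm_sub_le_of_lt hf hx.1 hxy hy.2
    · simp
    · rw [← enorm_neg, neg_sub]
      exact h.enorm_sub_le_of_lt hf hy.1 hxy hx.2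
  obtain ⟨ls, ns⟩ := hlim s hs
  obtain ⟨lt, nt⟩ := hlim t ht
  refine le_of_tendsto (ls.sub_const (f t)).enorm ?_
  filter_upwards [self_mem_nhdsWithin] with x hx
  refine le_of_tendsto (lt.const_sub (f x)).enorm ?_
  filter_upwards [self_mem_nhdsWithin] with y hy
  exact hopen x hx y hy

/-! ### Length of a set of edges -/

theorem Edge.isometry_point (e : Edge) : Isometry e.point := by
  refine Isometry.of_dist_eq fun s t => ?_
  rcases e with ⟨i, j⟩ | ⟨i, j⟩ <;>
    simp [Edge.point, EuclideanSpace.dist_eq, Fin.sum_univ_two, Real.sqrt_sq_eq_abs, Real.dist_eq]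

theorem Edge.measurableSet_openSegment (e : Edge) : MeasurableSet e.openSegment :=
  measurableSet_Ioo.image_of_continuousOn_injOn e.isometry_point.continuous.continuousOn
    e.isometry_point.injective.injOn

theorem Edge.length_openSegment (e : Edge) : length e.openSegment = 1 := by
  rw [length, Edge.openSegment, e.isometry_point.hausdorffMeasure_image (Or.inl zero_le_one),
    hausdorffMeasure_real]
  simp

theorem int_add_eq {i j : ℤ} {t : ℝ} (ht : t ∈ Ioo (0 : ℝ) 1) : (i : ℝ) + t ≠ j := by
  intro h
  have h1 : i < j := by exact_mod_cast (by linarith [ht.1] : (i : ℝ) < j)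
  have h2 : j < i + 1 := by exact_mod_cast (by linarith [ht.2] : (j : ℝ) < i + 1)
  omega

theorem int_eq_of_add_eq_add {i j : ℤ} {s t : ℝ} (hs : s ∈ Ioo (0 : ℝ) 1) (ht : t ∈ Ioo (0 : ℝ) 1)
    (h : (i : ℝ) + s = j + t) : i = j := by
  have h1 : i < j + 1 := by exact_mod_cast (by linarith [hs.1, ht.2] : (i : ℝ) < j + 1)
  have h2 : j < i + 1 := by exact_mod_cast (by linarith [hs.2, ht.1] : (j : ℝ) < i + 1)
  omega

theorem Edge.eq_of_point_eq {e f : Edge} {s t : ℝ} (hs : s ∈ Ioo (0 : ℝ) 1)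
    (ht : t ∈ Ioo (0 : ℝ) 1) (h : e.point s = f.point t) : e = f := by
  have h0 := congrArg (fun x : Plane => x 0) h
  have h1 := congrArg (fun x : Plane => x 1) h
  rcases e with ⟨i, j⟩ | ⟨i, j⟩ <;> rcases f with ⟨p, q⟩ | ⟨p, q⟩ <;> simp [Edge.point] at h0 h1
  · rw [int_eq_of_add_eq_add hs ht h0, h1]
  · exact (int_add_eq hs h0).elim
  · exact (int_add_eq hs h1).elim
  · rw [int_eq_of_add_eq_add hs ht h1, h0]

/-- Open edges are disjoint and of length one, so bounds on the lengths of defects are bounds on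
their numbers of edges. -/
theorem length_biUnion_openSegment (D : Set Edge) :
    length (⋃ e ∈ D, e.openSegment) = ∑' _ : D, 1 := by
  rw [length, measure_biUnion D.to_countable _ fun e _ => e.measurableSet_openSegment]
  · exact tsum_congr fun e => e.1.length_openSegment
  · intro e _ f _ hne
    refine disjoint_left.2 ?_
    rintro x ⟨s, hs, rfl⟩ ⟨t, ht, h⟩
    exact hne (Edge.eq_of_point_eq hs ht h.symm)

/-! ### Sobolev inequality on the full grid -/

theorem enorm_le_tsum_enorm_sub (b : ℤ → ℝ) (i : ℤ)
    (hb : ∀ ε : ℝ≥0∞, ε ≠ 0 → ∃ n : ℕ, ‖b (i + n)‖ₑ ≤ ε) : ‖b i‖ₑ ≤ ∑' k, ‖b (k + 1) - b k‖ₑ := by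
  have key : ∀ n : ℕ, ‖b i‖ₑ ≤
      ‖b (i + n)‖ₑ + ∑ k ∈ Finset.range n, ‖b (i + k + 1) - b (i + k)‖ₑ := by
    intro n
    induction n with
    | zero => simp
    | succ n ih =>
      refine ih.trans ?_
      rw [Finset.sum_range_succ, add_comm (∑ k ∈ Finset.range n, _), ← add_assoc]
      gcongr
      have : b (i + n) = b (i + (n + 1 : ℕ)) - (b (i + n + 1) - b (i + n)) := by
        push_cast
        rw [add_assoc]
        ring
      rw [this]
      refine enorm_sub_le.trans_eq ?_
      push_cast
      simp [add_assoc]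
  refine ENNReal.le_of_forall_pos_le_add fun ε hε _ => ?_
  obtain ⟨n, hn⟩ := hb ε (by simpa using hε.ne')
  rw [add_comm]
  refine (key n).trans (add_le_add hn ((ENNReal.sum_le_tsum _).trans ?_))
  exact ENNReal.tsum_comp_le_tsum_of_injective
    (f := fun k : ℕ => i + (k : ℤ)) (fun k l h => by simpa using h)
    fun k => ‖b (k + 1) - b k‖ₑ

/-- Discrete Gagliardo–Nirenberg–Sobolev inequality on the square grid. -/
theorem tsum_enorm_sq_le (F : ℤ × ℤ → ℝ)
    (hrow : ∀ i j (ε : ℝ≥0∞), ε ≠ 0 → ∃ n : ℕ, ‖F (i + n, j)‖ₑ ≤ ε)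
    (hcol : ∀ i j (ε : ℝ≥0∞), ε ≠ 0 → ∃ n : ℕ, ‖F (i, j + n)‖ₑ ≤ ε) :
    ∑' v, ‖F v‖ₑ ^ 2 ≤ (∑' e : Edge, ‖F e.tgt - F e.src‖ₑ) ^ 2 := by
  have h1 : ∀ i j, ‖F (i, j)‖ₑ ≤ ∑' k, ‖F (k + 1, j) - F (k, j)‖ₑ := fun i j =>
    enorm_le_tsum_enorm_sub (fun k => F (k, j)) i (hrow i j)
  have h2 : ∀ i j, ‖F (i, j)‖ₑ ≤ ∑' k, ‖F (i, k + 1) - F (i, k)‖ₑ := fun i j =>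
    enorm_le_tsum_enorm_sub (fun k => F (i, k)) j (hcol i j)
  have hs1 : ∑' j, ∑' k, ‖F (k + 1, j) - F (k, j)‖ₑ ≤ ∑' e : Edge, ‖F e.tgt - F e.src‖ₑ := by
    rw [tsum_edge, ENNReal.tsum_comm, ENNReal.tsum_prod']
    exact le_self_add
  have hs2 : ∑' i, ∑' k, ‖F (i, k + 1) - F (i, k)‖ₑ ≤ ∑' e : Edge, ‖F e.tgt - F e.src‖ₑ := by
    rw [tsum_edge, ENNReal.tsum_prod' (f := fun v : ℤ × ℤ =>
      ‖F (Edge.ver v.1 v.2).tgt - F (Edge.ver v.1 v.2).src‖ₑ)]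
    exact le_add_self
  calc ∑' v, ‖F v‖ₑ ^ 2 = ∑' i, ∑' j, ‖F (i, j)‖ₑ ^ 2 := ENNReal.tsum_prod'
    _ ≤ ∑' i, ∑' j, (∑' k, ‖F (i, k + 1) - F (i, k)‖ₑ) * ∑' k, ‖F (k + 1, j) - F (k, j)‖ₑ := by
      gcongr with i j
      rw [sq]
      exact mul_le_mul' (h2 i j) (h1 i j)
    -- The column variation depends only on `i` and the row variation only on `j`, so the double sum
    -- factors.
    _ = (∑' i, ∑' k, ‖F (i, k + 1) - F (i, k)‖ₑ) * ∑' j, ∑' k, ‖F (k + 1, j) - F (k, j)‖ₑ := by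
      simp_rw [ENNReal.tsum_mul_left, ENNReal.tsum_mul_right]
    _ ≤ _ := by
      rw [sq]
      exact mul_le_mul' hs2 hs1

theorem tsum_enorm_src_sq_le (F : ℤ × ℤ → ℝ) :
    ∑' e : Edge, ‖F e.src‖ₑ ^ 2 = 2 * ∑' v, ‖F v‖ₑ ^ 2 := by
  rw [tsum_edge, two_mul]
  rfl

theorem add_sq_le_four_mul (a b : ℝ≥0∞) : (a + b) ^ 2 ≤ 4 * a ^ 2 + 4 * b ^ 2 := by
  rcases le_total a b with h | h
  · calc (a + b) ^ 2 ≤ (b + b) ^ 2 := by gcongr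
      _ = 4 * b ^ 2 := by ring
      _ ≤ _ := le_add_self
  · calc (a + b) ^ 2 ≤ (a + a) ^ 2 := by gcongr
      _ = 4 * a ^ 2 := by ring
      _ ≤ _ := le_self_add

theorem Edge.point_zero (e : Edge) : e.point 0 = vertexPoint e.src := by
  rcases e with ⟨i, j⟩ | ⟨i, j⟩ <;> simp [Edge.point, vertexPoint, Edge.src]

theorem Edge.point_one (e : Edge) : e.point 1 = vertexPoint e.tgt := by
  rcases e with ⟨i, j⟩ | ⟨i, j⟩ <;> simp [Edge.point, vertexPoint, Edge.tgt]

/-! ### Extension from the defected grid to the full grid -/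

namespace DefectedGrid

variable {G : DefectedGrid}

variable (G) in
/-- The supremum of the lengths of the defects. -/
def maxDefect : ℝ≥0∞ := ⨆ (D : Set Edge) (_ : G.IsDefect D), length (⋃ e ∈ D, e.openSegment)

theorem tsum_cluster_le (c : ℤ × ℤ) : ∑' _ : G.cluster c, (1 : ℝ≥0∞) ≤ G.maxDefect := by
  rcases (G.cluster c).eq_empty_or_nonempty with h | h
  · rw [h]
    simp
  · rw [← length_biUnion_openSegment]
    exact le_iSup₂_of_le _ (isDefect_cluster h) le_rfl

theorem not_forall_mem_cluster (hG : G.HasUniformlyBoundedDefects) (c : ℤ × ℤ) {g : ℕ → Edge}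
    (hg : Function.Injective g) : ¬ ∀ n, g n ∈ G.cluster c := by
  intro h
  have : Infinite (G.cluster c) :=
    Infinite.of_injective (fun n => (⟨g n, h n⟩ : G.cluster c)) fun m n hmn =>
      hg (congrArg Subtype.val hmn)
  have h1 := tsum_cluster_le (G := G) c
  rw [ENNReal.tsum_const_eq_top_of_ne_zero one_ne_zero, top_le_iff] at h1
  exact hG.ne h1

/-- If the ray missed `G`, the cells along it would all be joined and its infinitely many edges
would lie in one cluster. -/
theorem exists_mem_verts_right (hG : G.HasUniformlyBoundedDefects) (i j : ℤ) :
    ∃ n : ℕ, (i + n, j) ∈ G.verts := by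
  by_contra! h
  have hrel : ∀ n : ℕ, G.CellRel (i, j) (i + n, j) := by
    intro n
    induction n with
    | zero => simpa using CellRel.refl _
    | succ n ih =>
      have := h (n + 1)
      push_cast at this ⊢
      rw [← add_assoc] at this ⊢
      exact ih.trans (cellRel_right this)
  refine not_forall_mem_cluster hG (i, j) (g := fun n => .hor (i + n) j) (fun m n h => ?_)
    fun n => ⟨(G.notMem_verts_iff _).1 (h n) _ (Or.inl rfl), _, hrel n, by simp [cell]⟩
  simpa using h

theorem exists_mem_verts_up (hG : G.HasUniformlyBoundedDefects) (i j : ℤ) :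
    ∃ n : ℕ, (i, j + n) ∈ G.verts := by
  by_contra! h
  have hrel : ∀ n : ℕ, G.CellRel (i, j) (i, j + n) := by
    intro n
    induction n with
    | zero => simpa using CellRel.refl _
    | succ n ih =>
      have := h (n + 1)
      push_cast at this ⊢
      rw [← add_assoc] at this ⊢
      exact ih.trans (cellRel_up this)
  refine not_forall_mem_cluster hG (i, j) (g := fun n => .ver i (j + n)) (fun m n h => ?_)
    fun n => ⟨(G.notMem_verts_iff _).1 (h n) _ (Or.inl rfl), _, hrel n, by simp [cell]⟩
  simpa using h

/-- Every vertex of the square grid has a nearby vertex of `G` in the cells joined to any of its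
cells. -/
theorem exists_representative (hG : G.HasUniformlyBoundedDefects) (w : ℤ × ℤ) :
    ∃ a ∈ G.verts, (w ∈ G.verts → a = w) ∧
      ∀ c, w ∈ corners c → ∃ c', G.CellRel c c' ∧ a ∈ corners c' := by
  by_cases hw : w ∈ G.verts
  · exact ⟨w, hw, fun _ => rfl, fun c hc => ⟨c, .refl c, hc⟩⟩
  · suffices ∃ a ∈ G.verts, ∃ c', G.CellRel w c' ∧ a ∈ corners c' by
      obtain ⟨a, ha, c', h1, h2⟩ := this
      exact ⟨a, ha, fun h => (hw h).elim,
        fun c hc => ⟨c', (cellRel_of_notMem_verts hw hc).trans h1, h2⟩⟩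
    -- Otherwise, moving right from `w`, every vertex met is a corner of a cell in the class of `w`
    -- and hence missing, so the whole ray misses `G`.
    by_contra! hcon
    obtain ⟨i, j⟩ := w
    have key : ∀ n : ℕ, G.CellRel (i, j) (i + n, j) ∧ (i + (n : ℤ), j) ∉ G.verts := by
      intro n
      induction n with
      | zero => simpa using ⟨CellRel.refl _, hw⟩
      | succ n ih =>
        have h1 : (i + (n : ℤ) + 1, j) ∉ G.verts := fun h =>
          hcon _ h _ ih.1 (by simp [corners])
        push_cast
        rw [← add_assoc]
        exact ⟨ih.1.trans (cellRel_right h1), h1⟩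
    obtain ⟨n, hn⟩ := exists_mem_verts_right hG i j
    exact (key n).2 hn

/-- A function on the vertices of `G` extends to the square grid with control of the total
variation. -/
theorem exists_extension (hG : G.HasUniformlyBoundedDefects) (f : ℤ × ℤ → ℝ) :
    ∃ F : ℤ × ℤ → ℝ, (∀ v ∈ G.verts, F v = f v) ∧
      ∑' e : Edge, ‖F e.tgt - F e.src‖ₑ ≤
        (1 + 2 * G.maxDefect) * ∑' e : G.edges, ‖f e.1.tgt - f e.1.src‖ₑ := by
  classical
  choose r hr hrv hrc using exists_representative hG
  refine ⟨fun v => f (r v), fun v hv => congrArg f (hrv v hv), ?_⟩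
  have hpres : ∀ e ∈ G.edges, r e.src = e.src ∧ r e.tgt = e.tgt := fun e he =>
    ⟨hrv _ (mem_verts_of_incident he (Or.inl rfl)), hrv _ (mem_verts_of_incident he (Or.inr rfl))⟩
  have hrem : ∀ e ∉ G.edges, ‖f (r e.tgt) - f (r e.src)‖ₑ ≤
      ∑' d : G.edges, if d.1 ∈ G.rim e.src then ‖f d.1.tgt - f d.1.src‖ₑ else 0 := by
    intro e he
    have hm : e ∈ cell e.src := mem_cell_iff.2 (Or.inl rfl)
    obtain ⟨p, hp, hap⟩ := hrc e.tgt e.src (mem_corners_of_incident hm (Or.inr rfl))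
    obtain ⟨q, hq, hbq⟩ := hrc e.src e.src (mem_corners_of_incident hm (Or.inl rfl))
    refine (enorm_sub_le_tsum_rim f e.src (hr _) (hr _) hp hq hap hbq).trans_eq ?_
    rw [tsum_subtype (G.rim e.src) fun d => ‖f d.tgt - f d.src‖ₑ,
      tsum_subtype G.edges fun d => if d ∈ G.rim e.src then ‖f d.tgt - f d.src‖ₑ else 0]
    refine tsum_congr fun d => ?_
    by_cases hd : d ∈ G.rim e.src
    · simp [hd, hd.1]
    · simp [hd, indicator]
  -- If `d` is in the rim of the class of `e.src`, one of the two cells containing `d` is in that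
  -- class, and `e` belongs to its cluster.
  have hcount : ∀ d : Edge, ∑' e : ↥G.edgesᶜ, (if d ∈ G.rim e.1.src then (1 : ℝ≥0∞) else 0) ≤
      2 * G.maxDefect := by
    intro d
    have hle : ∀ e : Edge, e ∉ G.edges → (if d ∈ G.rim e.src then (1 : ℝ≥0∞) else 0) ≤
        (G.cluster d.src).indicator 1 e + (G.cluster d.cellOpp).indicator 1 e := by
      intro e he
      split_ifs with h
      · obtain ⟨-, c, hc, hdc⟩ := h
        have hm : e ∈ G.cluster c := ⟨he, e.src, hc.symm, mem_cell_iff.2 (Or.inl rfl)⟩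
        rcases mem_cell_iff.1 hdc with rfl | rfl
        · rw [indicator_of_mem hm]
          exact le_self_add
        · rw [indicator_of_mem hm]
          exact le_add_self
      · exact zero_le
    calc _ ≤ ∑' e : ↥G.edgesᶜ, ((G.cluster d.src).indicator (1 : Edge → ℝ≥0∞) e.1 +
          (G.cluster d.cellOpp).indicator (1 : Edge → ℝ≥0∞) e.1) :=
          ENNReal.tsum_le_tsum fun e => hle e.1 e.2
      _ ≤ ∑' e : Edge, ((G.cluster d.src).indicator (1 : Edge → ℝ≥0∞) e +
          (G.cluster d.cellOpp).indicator (1 : Edge → ℝ≥0∞) e) :=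
          ENNReal.tsum_comp_le_tsum_of_injective Subtype.val_injective
            fun e => (G.cluster d.src).indicator (1 : Edge → ℝ≥0∞) e +
              (G.cluster d.cellOpp).indicator (1 : Edge → ℝ≥0∞) e
      _ = ∑' _ : G.cluster d.src, (1 : ℝ≥0∞) + ∑' _ : G.cluster d.cellOpp, (1 : ℝ≥0∞) := by
          rw [ENNReal.tsum_add, ← tsum_subtype, ← tsum_subtype]
          rfl
      _ ≤ _ := by
          rw [two_mul]
          exact add_le_add (tsum_cluster_le _) (tsum_cluster_le _)
  calc ∑' e : Edge, ‖f (r e.tgt) - f (r e.src)‖ₑ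
      = ∑' e : G.edges, ‖f (r e.1.tgt) - f (r e.1.src)‖ₑ +
        ∑' e : ↥G.edgesᶜ, ‖f (r e.1.tgt) - f (r e.1.src)‖ₑ :=
        (Summable.tsum_add_tsum_compl ENNReal.summable ENNReal.summable).symm
    _ ≤ ∑' e : G.edges, ‖f e.1.tgt - f e.1.src‖ₑ + ∑' e : ↥G.edgesᶜ, ∑' d : G.edges,
          if d.1 ∈ G.rim e.1.src then ‖f d.1.tgt - f d.1.src‖ₑ else 0 := by
        refine add_le_add (ENNReal.tsum_le_tsum fun e => ?_)
          (ENNReal.tsum_le_tsum fun e => hrem e.1 e.2)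
        rw [(hpres e.1 e.2).1, (hpres e.1 e.2).2]
    _ = ∑' e : G.edges, ‖f e.1.tgt - f e.1.src‖ₑ + ∑' d : G.edges,
          (∑' e : ↥G.edgesᶜ, if d.1 ∈ G.rim e.1.src then (1 : ℝ≥0∞) else 0) *
            ‖f d.1.tgt - f d.1.src‖ₑ := by
        rw [ENNReal.tsum_comm]
        simp_rw [← ENNReal.tsum_mul_right, ite_mul, one_mul, zero_mul]
    _ ≤ ∑' e : G.edges, ‖f e.1.tgt - f e.1.src‖ₑ + ∑' d : G.edges,
          2 * G.maxDefect * ‖f d.1.tgt - f d.1.src‖ₑ := by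
        gcongr with d
        exact hcount d.1
    _ = _ := by rw [ENNReal.tsum_mul_left, add_mul, one_mul]

/-! ### Decay along rays and the Sobolev inequality on `G` -/

/-- If the values of `F` on the vertices of `G` are controlled by a summable function of the incident
edges, then `F` is small at some vertex of every sequence that meets `G` infinitely often. -/
theorem exists_enorm_le {F : ℤ × ℤ → ℝ} {w : Edge → ℝ≥0∞} (hw : ∑' e : G.edges, w e ≠ ⊤)
    (hF : ∀ e ∈ G.edges, ∀ v, e.Incident v → ‖F v‖ₑ ≤ w e) {x : ℕ → ℤ × ℤ}
    (hx : Function.Injective x) (hxG : ∀ m, ∃ n, x (m + n) ∈ G.verts) {ε : ℝ≥0∞} (hε : ε ≠ 0) :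
    ∃ n, ‖F (x n)‖ₑ ≤ ε := by
  by_contra! hcon
  -- Only finitely many edges have weight at least `ε`; an injective sequence leaves their endpoints
  -- for good, but returns to `G`.
  have hfin := ENNReal.finite_const_le_of_tsum_ne_top hw hε
  have hT : (⋃ e ∈ {e : G.edges | ε ≤ w e}, ({e.1.src, e.1.tgt} : Set (ℤ × ℤ))).Finite :=
    hfin.biUnion fun e _ => toFinite _
  obtain ⟨m, hm⟩ := (hT.preimage hx.injOn).bddAbove
  obtain ⟨n, hn⟩ := hxG (m + 1)
  obtain ⟨e, he, hv⟩ := exists_incident hn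
  have : m + 1 + n ≤ m := hm (mem_iUnion₂.2 ⟨⟨e, he⟩, (hcon _).le.trans (hF e he _ hv), hv⟩)
  omega

theorem IsW11.continuousOn_onEdges {u : Plane → ℝ} {u' : Edge → ℝ → ℝ} (h : G.IsW11 u u') {e : Edge}
    (he : e ∈ G.edges) : ContinuousOn (onEdges u e) (Icc 0 1) :=
  h.continuousOn.comp e.isometry_point.continuous.continuousOn fun t ht =>
    mem_iUnion₂.2 ⟨e, he, t, ht, rfl⟩

theorem lpNorm_one (f : Edge → ℝ → ℝ) :
    G.lpNorm 1 f = ∑' e : G.edges, ∫⁻ t in Ioo (0 : ℝ) 1, ‖f e t‖ₑ := by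
  simp [lpNorm]

theorem IsW11.lpNorm_two_le (hG : G.HasUniformlyBoundedDefects) {u : Plane → ℝ}
    {u' : Edge → ℝ → ℝ} (h : G.IsW11 u u') :
    G.lpNorm 2 (onEdges u) ≤ 4 * (1 + 2 * G.maxDefect) * G.lpNorm 1 u' := by
  set f : ℤ × ℤ → ℝ := fun v => u (vertexPoint v) with hf
  set d : Edge → ℝ≥0∞ := fun e => ∫⁻ t in Ioo (0 : ℝ) 1, ‖u' e t‖ₑ with hd
  set X := G.lpNorm 1 u' with hX
  set K := 1 + 2 * G.maxDefect
  have hXd : X = ∑' e : G.edges, d e := lpNorm_one u'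
  have hosc : ∀ e ∈ G.edges, ∀ s ∈ Icc (0 : ℝ) 1, ∀ t ∈ Icc (0 : ℝ) 1,
      ‖onEdges u e s - onEdges u e t‖ₑ ≤ d e := fun e he s hs t ht =>
    (h.weakDeriv e he).enorm_sub_le (h.continuousOn_onEdges he) hs ht
  have hadd : ∀ e ∈ G.edges, ∀ s ∈ Icc (0 : ℝ) 1, ∀ t ∈ Icc (0 : ℝ) 1,
      ‖onEdges u e s‖ₑ ≤ ‖onEdges u e t‖ₑ + d e := fun e he s hs t ht => by
    calc ‖onEdges u e s‖ₑ = ‖onEdges u e t + (onEdges u e s - onEdges u e t)‖ₑ := by congr 1; ring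
      _ ≤ _ := (enorm_add_le _ _).trans (by gcongr; exact hosc e he s hs t ht)
  have h0 : ∀ e, onEdges u e 0 = f e.src := fun e => by simp [onEdges, hf, e.point_zero]
  have h1 : ∀ e, onEdges u e 1 = f e.tgt := fun e => by simp [onEdges, hf, e.point_one]
  obtain ⟨F, hFf, hF⟩ := exists_extension hG f
  have hFX : ∑' e : Edge, ‖F e.tgt - F e.src‖ₑ ≤ K * X := by
    refine hF.trans ?_
    rw [hXd]
    gcongr with e
    rw [← h0, ← h1]
    exact hosc e.1 e.2 1 (by simp) 0 (by simp)
  -- A vertex value is at most the mean of `|u|` over an incident edge plus the oscillation there.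
  -- These weights are summable since `u` is in `W^{1,1}`, which gives the decay needed along rays.
  have hval : ∀ e ∈ G.edges, ∀ v, e.Incident v →
      ‖F v‖ₑ ≤ (∫⁻ t in Ioo (0 : ℝ) 1, ‖onEdges u e t‖ₑ) + d e := by
    intro e he v hv
    obtain ⟨s, hs, hsv⟩ : ∃ s ∈ Icc (0 : ℝ) 1, onEdges u e s = f v := by
      rcases hv with rfl | rfl
      · exact ⟨0, by simp, h0 e⟩
      · exact ⟨1, by simp, h1 e⟩
    rw [hFf v (mem_verts_of_incident he hv), ← hsv]
    calc ‖onEdges u e s‖ₑ = ∫⁻ _ in Ioo (0 : ℝ) 1, ‖onEdges u e s‖ₑ := by simp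
      _ ≤ ∫⁻ t in Ioo (0 : ℝ) 1, (‖onEdges u e t‖ₑ + d e) :=
        setLIntegral_mono' measurableSet_Ioo fun t ht => hadd e he s hs t (Ioo_subset_Icc_self ht)
      _ = _ := by rw [lintegral_add_right _ measurable_const]; simp
  have hw : ∑' e : G.edges, ((∫⁻ t in Ioo (0 : ℝ) 1, ‖onEdges u e t‖ₑ) + d e) ≠ ⊤ := by
    rw [ENNReal.tsum_add, ← lpNorm_one, ← hXd]
    exact ENNReal.add_ne_top.2 ⟨h.norm_lt_top.ne, h.norm_deriv_lt_top.ne⟩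
  have hF2 : ∑' v, ‖F v‖ₑ ^ 2 ≤ (K * X) ^ 2 := by
    refine (tsum_enorm_sq_le F (fun i j ε hε => ?_) fun i j ε hε => ?_).trans (by gcongr)
    · refine exists_enorm_le (x := fun n => (i + n, j)) hw hval (fun m n h => by simpa using h)
        (fun m => ?_) hε
      obtain ⟨n, hn⟩ := exists_mem_verts_right hG (i + m) j
      exact ⟨n, by simpa [add_assoc] using hn⟩
    · refine exists_enorm_le (x := fun n => (i, j + n)) hw hval (fun m n h => by simpa using h)
        (fun m => ?_) hε
      obtain ⟨n, hn⟩ := exists_mem_verts_up hG i (j + m)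
      exact ⟨n, by simpa [add_assoc] using hn⟩
  have hedge : ∀ e : G.edges, ∫⁻ t in Ioo (0 : ℝ) 1, ‖onEdges u e t‖ₑ ^ (2 : ℝ) ≤
      4 * ‖F e.1.src‖ₑ ^ 2 + 4 * (d e * X) := by
    rintro ⟨e, he⟩
    -- Replacing `d e ^ 2` by `d e * X` makes the sum over the edges equal to `X ^ 2`.
    have hdX : d e ≤ X := hXd ▸ ENNReal.le_tsum (f := fun e : G.edges => d e) ⟨e, he⟩
    calc ∫⁻ t in Ioo (0 : ℝ) 1, ‖onEdges u e t‖ₑ ^ (2 : ℝ)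
        ≤ ∫⁻ _ in Ioo (0 : ℝ) 1, (4 * ‖F e.src‖ₑ ^ 2 + 4 * (d e * X)) := by
          refine setLIntegral_mono' measurableSet_Ioo fun t ht => ?_
          rw [ENNReal.rpow_two, hFf _ (mem_verts_of_incident he (Or.inl rfl)), ← h0]
          calc ‖onEdges u e t‖ₑ ^ 2 ≤ (‖onEdges u e 0‖ₑ + d e) ^ 2 := by
                gcongr
                exact hadd e he t (Ioo_subset_Icc_self ht) 0 (by simp)
            _ ≤ _ := add_sq_le_four_mul _ _
            _ ≤ _ := by rw [sq (d e)]; gcongr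
      _ = _ := by simp
  have htot : ∑' e : G.edges, ∫⁻ t in Ioo (0 : ℝ) 1, ‖onEdges u e t‖ₑ ^ (2 : ℝ) ≤
      (4 * K * X) ^ 2 := by
    calc _ ≤ ∑' e : G.edges, (4 * ‖F e.1.src‖ₑ ^ 2 + 4 * (d e * X)) := ENNReal.tsum_le_tsum hedge
      _ = 4 * ∑' e : G.edges, ‖F e.1.src‖ₑ ^ 2 + 4 * (1 * X) ^ 2 := by
        rw [ENNReal.tsum_add, ENNReal.tsum_mul_left, ENNReal.tsum_mul_left, ENNReal.tsum_mul_right,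
          ← hXd, one_mul, sq]
      -- Each vertex is the source of two edges, and `1 ≤ K`. The resulting `12` is then rounded up
      -- to `16` to have a perfect square.
      _ ≤ 4 * (2 * (K * X) ^ 2) + 4 * (K * X) ^ 2 := by
        gcongr
        · refine (ENNReal.tsum_comp_le_tsum_of_injective Subtype.val_injective
            fun e : Edge => ‖F e.src‖ₑ ^ 2).trans ?_
          rw [tsum_enorm_src_sq_le]
          gcongr
        · exact le_self_add
      _ = 12 * (K * X) ^ 2 := by ring
      _ ≤ 16 * (K * X) ^ 2 := by gcongr; norm_num
      _ = _ := by ring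
  calc G.lpNorm 2 (onEdges u) ≤ ((4 * K * X) ^ 2) ^ (1 / 2 : ℝ) :=
        ENNReal.rpow_le_rpow htot (by norm_num)
    _ = 4 * K * X := by
        rw [← ENNReal.rpow_two, ← ENNReal.rpow_mul]
        norm_num

end DefectedGrid

end SquareGrid

end

theorem theorem2p2 (G : SquareGrid.DefectedGrid) (hG : G.HasUniformlyBoundedDefects) :
    G.SupportsSobolev2D := by
  have hC : 4 * (1 + 2 * G.maxDefect) ≠ ⊤ :=
    ENNReal.mul_ne_top (by simp) (ENNReal.add_ne_top.2
      ⟨by simp, ENNReal.mul_ne_top (by simp) hG.ne⟩)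
  refine ⟨(4 * (1 + 2 * G.maxDefect)).toReal, ENNReal.toReal_pos (by simp) hC, fun u u' h => ?_⟩
  rw [ENNReal.ofReal_toReal hC]
  exact h.lpNorm_two_le hG
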